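/- Let $n\ge 2$ and let $\mathbb{H}^n$ be hyperbolic space of constant curvature $-1$ with its distance function $d(\cdot,\cdot)$. Let $N_1,N_2$ be smooth $(n-1)$-dimensional manifolds without boundary, $N_1$ compact, and let $F_k:N_k\times[0,T)\to\mathbb{H}^n$ ($k=1,2$) be smooth families of immersions that evolve by mean curvature flow, $$\partial_t F_k=-H\nu ,$$ where $\nu$ is a unit normal and $H=\frac{1}{n-1}(\kappa_1+\dots+\kappa_{n-1})$ is the mean curvature with respect to $\nu$, i.e. the average of the principal curvatures, with the sign for which geodesic spheres have $H>0$ with respect to the outer normal (the vector $H\nu$ does not depend on the choice of $\nu$). Suppose that the second flow, which need not be compact, is proper, i.e. the map $(x,t)\mapsto(F_2(x,t),t)$ from $N_2\times[0,T)$ to $\mathbb{H}^n\times[0,T)$ is proper. Put $\Sigma^k_t=F_k(N_k,t)$ and $$d(t)=\inf_{p\in\Sigma^1_t,\ q\in\Sigma^2_t} d(p,q).$$ Then for every $t\in[0,T)$ $$e^{t}\sinh\frac{d(t)}{2}\ \ge\ \sinh\frac{d(0)}{2},$$ and in particular $e^{t}\,d(t)\ge d(0)$. -/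

import Mathlib

open scoped Manifold ContDiff

noncomputable section

namespace HypMCF

/-- Minkowski space `ℝ^{1,n}`: a time coordinate and `n` space coordinates. -/
abbrev Minkowski (n : ℕ) : Type := ℝ × EuclideanSpace ℝ (Fin n)

/-- The Lorentzian inner product `⟨x, y⟩ = x₁ y₁ + ⋯ + xₙ yₙ - x₀ y₀`. -/
def lor {n : ℕ} (x y : Minkowski n) : ℝ := inner ℝ x.2 y.2 - x.1 * y.1

/-- Hyperbolic space `ℍⁿ` of constant curvature `-1`, as the upper sheet of the hyperboloid
`⟨p, p⟩ = -1`. Its tangent space at `p` is `{v | ⟨p, v⟩ = 0}`, and its Riemannian metric is the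
restriction of the Lorentzian inner product to the tangent spaces. -/
def hyperbolicSpace (n : ℕ) : Set (Minkowski n) := {p | lor p p = -1 ∧ 0 < p.1}

/-- The hyperbolic distance: `cosh d(p, q) = -⟨p, q⟩`. -/
def hdist {n : ℕ} (p q : Minkowski n) : ℝ := Real.arcosh (-lor p q)

/-- The distance `inf {d(p, q) | p ∈ A, q ∈ B}` between two subsets of `ℍⁿ`. -/
def setDist {n : ℕ} (A B : Set (Minkowski n)) : ℝ :=
  sInf {r | ∃ p ∈ A, ∃ q ∈ B, r = hdist p q}

section Hypersurface

variable {m : ℕ} {N : Type*} [TopologicalSpace N] [ChartedSpace (EuclideanSpace ℝ (Fin m)) N]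

/-- The map `f` read in the preferred chart of `N` around `x`. -/
def localRep (f : N → Minkowski (m + 1)) (x : N) : EuclideanSpace ℝ (Fin m) → Minkowski (m + 1) :=
  f ∘ (extChartAt (𝓡 m) x).symm

/-- The partial derivative `∂ᵢ f` at `x`, in the preferred chart around `x`. -/
def partialD (f : N → Minkowski (m + 1)) (x : N) (i : Fin m) : Minkowski (m + 1) :=
  fderiv ℝ (localRep f x) (extChartAt (𝓡 m) x x) (EuclideanSpace.single i 1)

/-- The second partial derivative `∂ᵢ ∂ⱼ f` at `x`, in the preferred chart around `x`. -/
def partialDD (f : N → Minkowski (m + 1)) (x : N) (i j : Fin m) : Minkowski (m + 1) :=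
  fderiv ℝ (fderiv ℝ (localRep f x)) (extChartAt (𝓡 m) x x)
    (EuclideanSpace.single i 1) (EuclideanSpace.single j 1)

/-- The induced metric (first fundamental form) `gᵢⱼ = ⟨∂ᵢ f, ∂ⱼ f⟩`. -/
def firstFF (f : N → Minkowski (m + 1)) (x : N) : Matrix (Fin m) (Fin m) ℝ :=
  Matrix.of fun i j => lor (partialD f x i) (partialD f x j)

/-- `ν` is a unit normal of the hypersurface `f : N → ℍ^{m+1}` at `x`: a unit vector, tangent to
`ℍ^{m+1}` at `f x` and orthogonal to the image of the differential of `f`. -/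
structure IsUnitNormal (f : N → Minkowski (m + 1)) (x : N) (ν : Minkowski (m + 1)) : Prop where
  tangent : lor (f x) ν = 0
  unit : lor ν ν = 1
  normal : ∀ i, lor (partialD f x i) ν = 0

/-- The second fundamental form `hᵢⱼ = -⟨∇ᵢ ∂ⱼ f, ν⟩` with respect to a unit normal `ν`, where `∇` is
the Levi-Civita connection of `ℍ^{m+1}`. This connection is the tangential part of the flat
derivative, the remainder being a multiple of `f x`, which is orthogonal to `ν`; hence
`⟨∇ᵢ ∂ⱼ f, ν⟩ = ⟨∂ᵢ ∂ⱼ f, ν⟩`. The sign makes spheres with outer normal have positive curvature. -/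
def secondFF (f : N → Minkowski (m + 1)) (x : N) (ν : Minkowski (m + 1)) :
    Matrix (Fin m) (Fin m) ℝ :=
  Matrix.of fun i j => -lor (partialDD f x i j) ν

/-- The mean curvature with respect to `ν`, `H = (κ₁ + ⋯ + κₘ) / m`: the average of the principal
curvatures, which are the eigenvalues of `g⁻¹ h`. -/
def meanCurvature (f : N → Minkowski (m + 1)) (x : N) (ν : Minkowski (m + 1)) : ℝ :=
  ((firstFF f x)⁻¹ * secondFF f x ν).trace / m

/-- `F : N × [0, T) → ℍ^{m+1}` is a smooth mean curvature flow of immersed hypersurfaces: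
`∂ₜ F = -H ν`. The vector `H ν` does not depend on which of the two unit normals is taken. The values
of `F` at times outside `[0, T)` play no role. -/
structure IsMCF (T : ℝ) (F : N → ℝ → Minkowski (m + 1)) : Prop where
  mem : ∀ x, ∀ t ∈ Set.Ico 0 T, F x t ∈ hyperbolicSpace (m + 1)
  smooth : ContMDiffOn ((𝓡 m).prod 𝓘(ℝ, ℝ)) 𝓘(ℝ, Minkowski (m + 1)) ∞
    (fun p : N × ℝ => F p.1 p.2) (Set.univ ×ˢ Set.Ico 0 T)
  immersion : ∀ x, ∀ t ∈ Set.Ico 0 T, Function.Injective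
    (mfderiv (𝓡 m) 𝓘(ℝ, Minkowski (m + 1)) (fun y => F y t) x)
  flow : ∀ x, ∀ t ∈ Set.Ico 0 T, ∃ ν, IsUnitNormal (fun y => F y t) x ν ∧
    HasDerivWithinAt (fun s => F x s) (-(meanCurvature (fun y => F y t) x ν • ν)) (Set.Ico 0 T) t

/-- The flow is proper in space-time: `(x, t) ↦ (F(x, t), t)` is a proper map on `N × [0, T)`.
Equivalently, the time slices are properly immersed and the mean curvature is bounded on the
part of the flow in `K × [0, T']` for every compact `K` and every `T' < T`. It holds for every flow
of a compact `N`. -/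
def IsProperFlow (T : ℝ) (F : N → ℝ → Minkowski (m + 1)) : Prop :=
  IsProperMap fun p : N × Set.Ico (0 : ℝ) T => (F p.1 p.2, p.2)

/-- The time slice `Σₜ = F(N, t)`. -/
def slice (F : N → ℝ → Minkowski (m + 1)) (t : ℝ) : Set (Minkowski (m + 1)) :=
  Set.range fun x => F x t

/-- The distance `d(t)` between the time slices of two flows. -/
def flowDist {N' : Type*} (F₁ : N → ℝ → Minkowski (m + 1)) (F₂ : N' → ℝ → Minkowski (m + 1))
    (t : ℝ) : ℝ :=
  setDist (slice F₁ t) (slice F₂ t)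

end Hypersurface

end HypMCF

end

open scoped Manifold ContDiff

noncomputable section

/-! Work with `Z = -⟨p, q⟩ - 1 = cosh d - 1 = 2 sinh² (d/2)`, which is smooth even where `d = 0`.
The claim becomes that the minimum of `exp (2t) Z` over pairs of points never falls below its
initial infimum.

At a closest pair of distinct points `p`, `q`, the first variation makes both tangent hyperplanes
equal to the orthogonal complement of `span {p, q}` in Minkowski space. One orthonormal frame
therefore serves both hypersurfaces, and the two points can be moved in the same Minkowski direction
`e`. The second variation of `-⟨p, q⟩` then contains the cross term `-2⟨e, e⟩ = -2`. The normal
parts of the second derivatives give the second fundamental forms, and the parts along `p` and `q`,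
known from `⟨f, f⟩ = -1`, add `-2⟨p, q⟩`. Averaging over the frame yields `H₁⟨q, ν₁⟩ + H₂⟨p, ν₂⟩ ≥
-2Z` (`meanCurvature_comparison`). The left side is exactly the time derivative of `Z` under the two
flows.

A maximum principle turns this into the bound on `exp (2t) Z` (`lower_bound_of_two_lt`,
`lower_bound`). Properness of the second flow and compactness of the first supply a first time at
which a bound fails, together with a pair realizing it (`isCompact_sublevel`). Taking square roots
gives the `sinh` estimate, and convexity of `sinh` on `[0, ∞)` gives the linear one. -/

namespace HypMCF

/-! ### Lorentzian geometry of the hyperboloid -/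

section Lorentz

variable {n : ℕ}

/-- The Lorentzian inner product as a bilinear form. -/
def lorForm (n : ℕ) : Minkowski n →ₗ[ℝ] Minkowski n →ₗ[ℝ] ℝ :=
  LinearMap.mk₂ ℝ lor
    (fun x y z => by simp only [lor, Prod.fst_add, Prod.snd_add, inner_add_left]; ring)
    (fun c x y => by
      simp only [lor, Prod.smul_fst, Prod.smul_snd, real_inner_smul_left, smul_eq_mul]; ring)
    (fun x y z => by simp only [lor, Prod.fst_add, Prod.snd_add, inner_add_right]; ring)
    (fun c x y => by
      simp only [lor, Prod.smul_fst, Prod.smul_snd, real_inner_smul_right, smul_eq_mul]; ring)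

lemma lorForm_apply (x y : Minkowski n) : lorForm n x y = lor x y := rfl

lemma lor_comm (x y : Minkowski n) : lor x y = lor y x := by
  simp only [lor, real_inner_comm, mul_comm]

lemma lor_add_left (x y z : Minkowski n) : lor (x + y) z = lor x z + lor y z :=
  (lorForm n).map_add₂ x y z

lemma lor_smul_left (c : ℝ) (x y : Minkowski n) : lor (c • x) y = c * lor x y :=
  (lorForm n).map_smul₂ c x y

lemma lor_add_right (x y z : Minkowski n) : lor x (y + z) = lor x y + lor x z :=
  (lorForm n x).map_add y z

lemma lor_sub_right (x y z : Minkowski n) : lor x (y - z) = lor x y - lor x z :=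
  (lorForm n x).map_sub y z

lemma lor_smul_right (c : ℝ) (x y : Minkowski n) : lor x (c • y) = c * lor x y :=
  (lorForm n x).map_smul c y

lemma lor_neg_left (x y : Minkowski n) : lor (-x) y = -lor x y :=
  (lorForm n).map_neg₂ x y

lemma lor_neg_right (x y : Minkowski n) : lor x (-y) = -lor x y :=
  (lorForm n x).map_neg y

lemma lor_zero_right (x : Minkowski n) : lor x 0 = 0 :=
  (lorForm n x).map_zero

lemma continuous_lor : Continuous fun p : Minkowski n × Minkowski n => lor p.1 p.2 := by
  unfold lor; fun_prop

lemma HasDerivWithinAt.lor {c₁ c₂ : ℝ → Minkowski n} {v₁ v₂ : Minkowski n} {s : Set ℝ} {t : ℝ}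
    (h₁ : HasDerivWithinAt c₁ v₁ s t) (h₂ : HasDerivWithinAt c₂ v₂ s t) :
    HasDerivWithinAt (fun r => lor (c₁ r) (c₂ r)) (lor v₁ (c₂ t) + lor (c₁ t) v₂) s t := by
  have hf {c : ℝ → Minkowski n} {v : Minkowski n} (h : HasDerivWithinAt c v s t) :
      HasDerivWithinAt (fun r => (c r).1) v.1 s t :=
    (ContinuousLinearMap.fst ℝ ℝ (EuclideanSpace ℝ (Fin n))).hasFDerivAt.comp_hasDerivWithinAt t h
  have hs {c : ℝ → Minkowski n} {v : Minkowski n} (h : HasDerivWithinAt c v s t) :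
      HasDerivWithinAt (fun r => (c r).2) v.2 s t :=
    (ContinuousLinearMap.snd ℝ ℝ (EuclideanSpace ℝ (Fin n))).hasFDerivAt.comp_hasDerivWithinAt t h
  refine (((hs h₁).inner ℝ (hs h₂)).sub ((hf h₁).mul (hf h₂))).congr_deriv ?_
  simp only [HypMCF.lor]; ring

lemma HasDerivAt.lor {c₁ c₂ : ℝ → Minkowski n} {v₁ v₂ : Minkowski n} {t : ℝ}
    (h₁ : HasDerivAt c₁ v₁ t) (h₂ : HasDerivAt c₂ v₂ t) :
    HasDerivAt (fun r => lor (c₁ r) (c₂ r)) (lor v₁ (c₂ t) + lor (c₁ t) v₂) t := by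
  rw [← hasDerivWithinAt_univ] at *
  exact HasDerivWithinAt.lor h₁ h₂

lemma norm_sq_of_mem {p : Minkowski n} (hp : p ∈ hyperbolicSpace n) : ‖p.2‖ ^ 2 = p.1 ^ 2 - 1 := by
  have := hp.1
  rw [lor, real_inner_self_eq_norm_sq] at this
  linarith

lemma norm_lt_of_mem {p : Minkowski n} (hp : p ∈ hyperbolicSpace n) : ‖p.2‖ < p.1 := by
  have := norm_sq_of_mem hp
  exact lt_of_pow_lt_pow_left₀ 2 hp.2.le (by linarith)

/-- The Lorentzian inner product is positive definite on the tangent spaces of `ℍⁿ`. -/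
lemma lor_self_pos_of_tangent {p v : Minkowski n} (hp : p ∈ hyperbolicSpace n)
    (hv : lor p v = 0) (h0 : v ≠ 0) : 0 < lor v v := by
  have hp2 := norm_sq_of_mem hp
  have hpos := hp.2
  have hin : inner ℝ p.2 v.2 = p.1 * v.1 := by rw [lor] at hv; linarith
  have hcs : (p.1 * v.1) ^ 2 ≤ ‖p.2‖ ^ 2 * ‖v.2‖ ^ 2 := by
    rw [← hin, ← mul_pow, sq_le_sq]
    exact (abs_real_inner_le_norm _ _).trans (le_abs_self _)
  have hv2 : 0 < ‖v.2‖ ^ 2 := by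
    by_contra hcon
    have hz : v.2 = 0 := by
      by_contra hne
      exact hcon (by positivity)
    rw [hz, inner_zero_right] at hin
    exact h0 (Prod.ext ((mul_eq_zero.1 hin.symm).resolve_left hpos.ne') hz)
  rw [lor, real_inner_self_eq_norm_sq]
  -- Cauchy–Schwarz reads `p₀² v₀² ≤ (p₀² - 1) ‖v.2‖²`, so this product is at least `‖v.2‖²`.
  have : 0 < p.1 ^ 2 * (‖v.2‖ ^ 2 - v.1 * v.1) := by rw [hp2] at hcs; nlinarith
  exact pos_of_mul_pos_right this (by positivity)

/-- Reversed Cauchy–Schwarz: after squaring, `(p₀² - 1)(q₀² - 1) ≤ (p₀ q₀ - 1)²` amounts to `(p₀ -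
q₀)² ≥ 0`. It keeps `arcosh` within the range where it inverts `cosh`. -/
lemma one_le_neg_lor {p q : Minkowski n} (hp : p ∈ hyperbolicSpace n)
    (hq : q ∈ hyperbolicSpace n) : 1 ≤ -lor p q := by
  have hpos : 0 < p.1 * q.1 := mul_pos hp.2 hq.2
  have hcs := real_inner_le_norm p.2 q.2
  have hp2 := norm_sq_of_mem hp
  have hq2 := norm_sq_of_mem hq
  have hp1 := norm_lt_of_mem hp
  have hq1 := norm_lt_of_mem hq
  have h : ‖p.2‖ * ‖q.2‖ ≤ p.1 * q.1 - 1 := by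
    have h1 : 1 ≤ p.1 * q.1 := by nlinarith [hp.2, hq.2, sq_nonneg ‖p.2‖, sq_nonneg ‖q.2‖]
    refine le_of_sq_le_sq ?_ (by linarith)
    rw [mul_pow, hp2, hq2]
    nlinarith [sq_nonneg (p.1 - q.1)]
  rw [lor]; linarith

/-- The time coordinate grows at most like the hyperbolic cosine of the distance. -/
lemma fst_le_of_mem {p q : Minkowski n} (hp : p ∈ hyperbolicSpace n)
    (hq : q ∈ hyperbolicSpace n) : q.1 ≤ 2 * p.1 * (-lor p q) := by
  have hcs := real_inner_le_norm p.2 q.2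
  have hp2 := norm_sq_of_mem hp
  have hp1 := norm_lt_of_mem hp
  have hq1 := norm_lt_of_mem hq
  have hn := norm_nonneg p.2
  have hq0 := hq.2
  have h1 : q.1 * (p.1 - ‖p.2‖) ≤ -lor p q := by
    rw [lor]
    nlinarith [mul_le_mul_of_nonneg_left hq1.le hn]
  -- On the hyperboloid `(p₀ + ‖p.2‖)(p₀ - ‖p.2‖) = 1`.
  calc q.1 = (p.1 + ‖p.2‖) * (q.1 * (p.1 - ‖p.2‖)) := by linear_combination (q.1) * hp2
    _ ≤ (2 * p.1) * (q.1 * (p.1 - ‖p.2‖)) :=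
        mul_le_mul_of_nonneg_right (by linarith) (mul_nonneg hq0.le (by linarith))
    _ ≤ _ := mul_le_mul_of_nonneg_left h1 (by linarith)

lemma norm_le_fst_of_mem {p : Minkowski n} (hp : p ∈ hyperbolicSpace n) : ‖p‖ ≤ p.1 := by
  rw [Prod.norm_def, Real.norm_eq_abs, abs_of_pos hp.2]
  exact max_le le_rfl (norm_lt_of_mem hp).le

lemma hdist_nonneg {p q : Minkowski n} (hp : p ∈ hyperbolicSpace n)
    (hq : q ∈ hyperbolicSpace n) : 0 ≤ hdist p q :=
  Real.arcosh_nonneg (one_le_neg_lor hp hq)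

lemma two_mul_sinh_half_hdist_sq {p q : Minkowski n} (hp : p ∈ hyperbolicSpace n)
    (hq : q ∈ hyperbolicSpace n) : 2 * Real.sinh (hdist p q / 2) ^ 2 = -lor p q - 1 := by
  have h := Real.cosh_arcosh (one_le_neg_lor hp hq)
  have h2 := Real.cosh_two_mul (hdist p q / 2)
  rw [mul_div_cancel₀ _ two_ne_zero, Real.cosh_sq, hdist, h] at h2
  rw [hdist]; linarith

end Lorentz

/-! ### Traces in frames and the common tangent space -/

section LinearAlgebra

variable {m : ℕ}

/-- The trace of a bilinear form with respect to an inner product can be computed in any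
orthonormal frame. -/
lemma trace_inv_mul_of_orthonormal
    (G B : EuclideanSpace ℝ (Fin m) →ₗ[ℝ] EuclideanSpace ℝ (Fin m) →ₗ[ℝ] ℝ)
    (a : Fin m → EuclideanSpace ℝ (Fin m))
    (ha : ∀ k l, G (a k) (a l) = if k = l then 1 else 0) :
    ((Matrix.of fun i j => G (EuclideanSpace.single i 1) (EuclideanSpace.single j 1))⁻¹ *
      Matrix.of fun i j => B (EuclideanSpace.single i 1) (EuclideanSpace.single j 1)).trace =
      ∑ k, B (a k) (a k) := by
  set P : Matrix (Fin m) (Fin m) ℝ := Matrix.of fun i k => a k i with hP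
  have hsum : ∀ k, a k = ∑ i, P i k • EuclideanSpace.single i (1 : ℝ) := by
    intro k
    ext j
    simp [hP, Finset.sum_apply, Pi.single_apply]
  have hconj : ∀ C : EuclideanSpace ℝ (Fin m) →ₗ[ℝ] EuclideanSpace ℝ (Fin m) →ₗ[ℝ] ℝ,
      P.transpose * (Matrix.of fun i j =>
        C (EuclideanSpace.single i 1) (EuclideanSpace.single j 1)) * P =
        Matrix.of fun k l => C (a k) (a l) := by
    intro C
    ext k l
    rw [Matrix.of_apply, hsum k, hsum l]
    simp only [Matrix.mul_apply, Matrix.transpose_apply, Matrix.of_apply, map_sum, map_smul,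
      LinearMap.sum_apply, LinearMap.smul_apply, smul_eq_mul, Finset.sum_mul, Finset.mul_sum]
    refine Finset.sum_congr rfl fun j _ => Finset.sum_congr rfl fun i _ => ?_
    ring
  have hone := hconj G
  rw [show (Matrix.of fun k l => G (a k) (a l)) = (1 : Matrix (Fin m) (Fin m) ℝ) by
    ext k l; rw [Matrix.of_apply, ha, Matrix.one_apply]] at hone
  set M := Matrix.of fun i j => G (EuclideanSpace.single i 1) (EuclideanSpace.single j 1)
  -- Orthonormality says `Pᵀ M P = 1`; one-sided inverses of square matrices are two-sided.
  have hinv : M⁻¹ = P * P.transpose := by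
    apply Matrix.inv_eq_right_inv
    have h1 : P * (P.transpose * M) = 1 := mul_eq_one_comm.1 hone
    rw [← mul_assoc] at h1
    exact mul_eq_one_comm.1 h1
  rw [hinv, mul_assoc, Matrix.trace_mul_comm, hconj B]
  rfl

lemma exists_orthonormal_frame
    (G : EuclideanSpace ℝ (Fin m) →ₗ[ℝ] EuclideanSpace ℝ (Fin m) →ₗ[ℝ] ℝ)
    (hsymm : ∀ v w, G v w = G w v) (hpos : ∀ v, v ≠ 0 → 0 < G v v) :
    ∃ a : Fin m → EuclideanSpace ℝ (Fin m), ∀ k l, G (a k) (a l) = if k = l then 1 else 0 := by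
  obtain ⟨v, hv⟩ := LinearMap.BilinForm.exists_orthogonal_basis (B := G) ⟨hsymm⟩
  let e : Fin m ≃ Fin (Module.finrank ℝ (EuclideanSpace ℝ (Fin m))) := finCongr (by simp)
  refine ⟨fun k => (√(G (v (e k)) (v (e k))))⁻¹ • v (e k), fun k l => ?_⟩
  simp only [map_smul, LinearMap.smul_apply, smul_eq_mul]
  split_ifs with hkl
  · subst hkl
    have h := hpos _ (v.ne_zero (e k))
    have hs := Real.mul_self_sqrt h.le
    have := (Real.sqrt_pos.2 h).ne'
    field_simp
    rw [sq, hs]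
  · rw [show G (v (e k)) (v (e l)) = 0 from hv (fun h => hkl (e.injective h))]
    simp

/-- An injective linear map from `ℝᵐ` to the orthogonal complement of two distinct points
of `ℍ^{m+1}` is onto it. -/
lemma mem_range_of_orthogonal {p q : Minkowski (m + 1)} (hp : p ∈ hyperbolicSpace (m + 1))
    (hq : q ∈ hyperbolicSpace (m + 1)) (hpq : 1 < -lor p q)
    (A : EuclideanSpace ℝ (Fin m) →ₗ[ℝ] Minkowski (m + 1)) (hA : Function.Injective A)
    (hAp : ∀ v, lor p (A v) = 0) (hAq : ∀ v, lor q (A v) = 0) {w : Minkowski (m + 1)}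
    (hwp : lor p w = 0) (hwq : lor q w = 0) : ∃ v, A v = w := by
  let φ : Minkowski (m + 1) →ₗ[ℝ] ℝ × ℝ := (lorForm (m + 1) p).prod (lorForm (m + 1) q)
  have hφ : ∀ x, φ x = (lor p x, lor q x) := fun x => rfl
  have hsurj : LinearMap.range φ = ⊤ := by
    rw [LinearMap.range_eq_top]
    rintro ⟨α, β⟩
    have hpp := hp.1
    have hqq := hq.1
    have hne : 1 - lor p q ^ 2 ≠ 0 := by nlinarith
    -- The coefficients solve the linear system with the Gram matrix of `p, q`, whose diagonal is
    -- `-1` and whose determinant is `1 - ⟨p, q⟩²`.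
    refine ⟨((-α - lor p q * β) / (1 - lor p q ^ 2)) • p +
      ((-β - lor p q * α) / (1 - lor p q ^ 2)) • q, ?_⟩
    rw [hφ]
    simp only [lor_add_right, lor_smul_right, lor_comm q p, hpp, hqq]
    ext
    · simp only; field_simp; ring
    · simp only; field_simp; ring
  have hrank := φ.finrank_range_add_finrank_ker
  rw [hsurj, finrank_top, Module.finrank_prod, Module.finrank_prod, finrank_euclideanSpace_fin,
    Module.finrank_self] at hrank
  have hle : LinearMap.range A ≤ LinearMap.ker φ := by
    rintro _ ⟨v, rfl⟩
    rw [LinearMap.mem_ker, hφ, hAp, hAq]; rfl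
  have hfr : Module.finrank ℝ (LinearMap.range A) = m := by
    rw [LinearMap.finrank_range_of_inj hA, finrank_euclideanSpace_fin]
  have heq := Submodule.eq_of_le_of_finrank_le hle (by omega)
  have : w ∈ LinearMap.range A := by
    rw [heq, LinearMap.mem_ker, hφ, hwp, hwq]; rfl
  exact this

/-- The component of `q` orthogonal to a hypersurface through `p` whose tangent space is orthogonal
to `q`. -/
lemma lor_eq_of_normal {p q ν : Minkowski (m + 1)} (hp : p ∈ hyperbolicSpace (m + 1))
    (hq : q ∈ hyperbolicSpace (m + 1)) (hpq : 1 < -lor p q)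
    (A : EuclideanSpace ℝ (Fin m) →ₗ[ℝ] Minkowski (m + 1)) (hA : Function.Injective A)
    (hAp : ∀ v, lor p (A v) = 0) (hAq : ∀ v, lor q (A v) = 0)
    (hνp : lor p ν = 0) (hν : lor ν ν = 1) (hνA : ∀ v, lor (A v) ν = 0) (X : Minkowski (m + 1)) :
    lor X q = lor q ν * lor X ν - lor p q * lor X p := by
  have hpp := hp.1
  have hqq := hq.1
  have hβ : lor p q ^ 2 - 1 ≠ 0 := by nlinarith
  set β := lor p q ^ 2 - 1 with hβd
  set c := lor q ν / β with hc
  have hcβ : c * β = lor q ν := div_mul_cancel₀ _ hβ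
  -- `q + ⟨p, q⟩ p` is the part of `q` orthogonal to `p`, with square `β`, so `w` is `ν` without its
  -- projection to `span {p, q}`. Thus `w` is tangent to the hypersurface, hence orthogonal to `ν`,
  -- `p` and `q`, hence null; definiteness on the tangent space at `p` forces `w = 0`.
  set w := ν - c • (q + lor p q • p) with hw
  have hwp : lor p w = 0 := by
    simp only [hw, lor_sub_right, lor_smul_right, lor_add_right, hνp, hpp]; ring
  have hwq : lor q w = 0 := by
    simp only [hw, lor_sub_right, lor_smul_right, lor_add_right, hqq, lor_comm q p]
    rw [← hcβ, hβd]; ring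
  obtain ⟨v, hv⟩ := mem_range_of_orthogonal hp hq hpq A hA hAp hAq hwp hwq
  have hww : lor w w = 0 := by
    have h1 : lor w w = lor (A v) w := by rw [hv]
    rw [h1, hw]
    simp only [lor_sub_right, lor_smul_right, lor_add_right, hνA, lor_comm (A v) q,
      lor_comm (A v) p, hAp, hAq]
    ring
  have hw0 : w = 0 := by
    by_contra h
    exact (lor_self_pos_of_tangent hp hwp h).ne' hww
  have hνeq : ν = c • (q + lor p q • p) := sub_eq_zero.1 hw0
  have hcq : c * lor q ν = 1 := by
    have h2 : lor ν ν = lor (c • (q + lor p q • p)) ν := by rw [← hνeq]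
    rw [hν, lor_smul_left, lor_add_left, lor_smul_left, hνp] at h2
    linarith
  have hXν : lor X ν = c * (lor X q + lor p q * lor X p) := by
    rw [hνeq, lor_smul_right, lor_add_right, lor_smul_right]
  rw [hXν]
  linear_combination (-(lor X q + lor p q * lor X p)) * hcq

end LinearAlgebra

/-! ### Second order calculus along lines -/

section Calculus

open Filter Topology

/-- The necessary second order condition for a local minimum. -/
lemma second_deriv_nonneg_of_isLocalMin {φ φ' : ℝ → ℝ} {φ'' s₀ : ℝ} (hmin : IsLocalMin φ s₀)
    (h₁ : ∀ᶠ s in 𝓝 s₀, HasDerivAt φ (φ' s) s) (h₂ : HasDerivAt φ' φ'' s₀) : 0 ≤ φ'' := by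
  by_contra! hneg
  have hd : deriv φ =ᶠ[𝓝 s₀] φ' := h₁.mono fun s hs => hs.deriv
  have hdd : deriv (deriv φ) s₀ = φ'' := by rw [hd.deriv_eq, h₂.deriv]
  have hmax := isLocalMax_of_deriv_deriv_neg (hdd ▸ hneg) hmin.deriv_eq_zero
    h₁.self_of_nhds.continuousAt
  -- A negative second derivative makes the minimum a maximum as well, so `φ` is locally constant
  -- and its second derivative vanishes.
  have hconst : φ =ᶠ[𝓝 s₀] fun _ => φ s₀ := by
    filter_upwards [hmin, hmax] with s h h' using le_antisymm h' h
  have hz : deriv φ =ᶠ[𝓝 s₀] fun _ => 0 := by simpa using hconst.deriv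
  rw [hz.deriv_eq, deriv_const] at hdd
  exact hneg.ne hdd.symm

variable {E V : Type*} [NormedAddCommGroup E] [NormedSpace ℝ E] [NormedAddCommGroup V]
  [NormedSpace ℝ V]

lemma eventually_hasDerivAt_line {f : E → V} {u : E} (hf : ContDiffAt ℝ 2 f u) (a : E) :
    ∀ᶠ s in 𝓝 (0 : ℝ), HasDerivAt (fun s : ℝ => f (u + s • a)) (fderiv ℝ f (u + s • a) a) s := by
  have hcont : Tendsto (fun s : ℝ => u + s • a) (𝓝 0) (𝓝 u) := by
    have : Continuous fun s : ℝ => u + s • a := by fun_prop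
    simpa using this.tendsto 0
  filter_upwards [hcont.eventually (hf.eventually (by simp))] with s hs
  have hl : HasDerivAt (fun s : ℝ => u + s • a) a s := by
    simpa using ((hasDerivAt_id s).smul_const a).const_add u
  exact (hs.differentiableAt (by simp)).hasFDerivAt.comp_hasDerivAt s hl

lemma hasDerivAt_fderiv_line {f : E → V} {u : E} (hf : ContDiffAt ℝ 2 f u) (a : E) :
    HasDerivAt (fun s : ℝ => fderiv ℝ f (u + s • a) a) (fderiv ℝ (fderiv ℝ f) u a a) 0 := by
  have hl : HasDerivAt (fun s : ℝ => u + s • a) a 0 := by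
    simpa using ((hasDerivAt_id (0 : ℝ)).smul_const a).const_add u
  have hd : DifferentiableAt ℝ (fderiv ℝ f) u :=
    (hf.fderiv_right (m := 1) (by norm_num)).differentiableAt (by simp)
  have h := HasFDerivAt.comp_hasDerivAt (f := fun s : ℝ => u + s • a) 0
    (by simpa using hd.hasFDerivAt) hl
  simpa using h.clm_apply (hasDerivAt_const 0 a)

end Calculus

/-! ### First and second variation of `-⟨p, q⟩` -/

section SecondVariation

open Filter Topology

variable {n : ℕ} {E : Type*} [NormedAddCommGroup E] [NormedSpace ℝ E]

lemma eventually_hasDerivAt_lor_line {f₁ f₂ : E → Minkowski n} {u₁ u₂ : E}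
    (h₁ : ContDiffAt ℝ 2 f₁ u₁) (h₂ : ContDiffAt ℝ 2 f₂ u₂) (a b : E) :
    ∀ᶠ s in 𝓝 (0 : ℝ), HasDerivAt (fun s : ℝ => lor (f₁ (u₁ + s • a)) (f₂ (u₂ + s • b)))
      (lor (fderiv ℝ f₁ (u₁ + s • a) a) (f₂ (u₂ + s • b)) +
        lor (f₁ (u₁ + s • a)) (fderiv ℝ f₂ (u₂ + s • b) b)) s := by
  filter_upwards [eventually_hasDerivAt_line h₁ a, eventually_hasDerivAt_line h₂ b] with s ha hb
  exact HasDerivAt.lor ha hb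

lemma hasDerivAt_deriv_lor_line {f₁ f₂ : E → Minkowski n} {u₁ u₂ : E}
    (h₁ : ContDiffAt ℝ 2 f₁ u₁) (h₂ : ContDiffAt ℝ 2 f₂ u₂) (a b : E) :
    HasDerivAt (fun s : ℝ => lor (fderiv ℝ f₁ (u₁ + s • a) a) (f₂ (u₂ + s • b)) +
        lor (f₁ (u₁ + s • a)) (fderiv ℝ f₂ (u₂ + s • b) b))
      (lor (fderiv ℝ (fderiv ℝ f₁) u₁ a a) (f₂ u₂) +
        2 * lor (fderiv ℝ f₁ u₁ a) (fderiv ℝ f₂ u₂ b) +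
        lor (f₁ u₁) (fderiv ℝ (fderiv ℝ f₂) u₂ b b)) 0 := by
  have ha := (eventually_hasDerivAt_line h₁ a).self_of_nhds
  have hb := (eventually_hasDerivAt_line h₂ b).self_of_nhds
  have haa := hasDerivAt_fderiv_line h₁ a
  have hbb := hasDerivAt_fderiv_line h₂ b
  refine ((HasDerivAt.lor haa hb).add (HasDerivAt.lor ha hbb)).congr_deriv ?_
  simp only [zero_smul, add_zero]
  ring

variable {f : E → Minkowski n} {u : E}

lemma lor_fderiv_eq_zero (hf : ContDiffAt ℝ 2 f u) (hmem : ∀ v, f v ∈ hyperbolicSpace n) (a : E) :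
    lor (f u) (fderiv ℝ f u a) = 0 := by
  have h := (eventually_hasDerivAt_lor_line hf hf a a).self_of_nhds
  have hc : (fun s : ℝ => lor (f (u + s • a)) (f (u + s • a))) = fun _ => -1 :=
    funext fun s => (hmem _).1
  rw [hc] at h
  have h0 := h.unique (hasDerivAt_const _ _)
  simp only [zero_smul, add_zero] at h0
  rw [lor_comm (fderiv ℝ f u a)] at h0
  linarith

/-- Differentiate `⟨f, f⟩ = -1` twice along a line. This is the curvature of the hyperboloid in
Minkowski space, and the source of the zeroth order term in the comparison. -/
lemma lor_fderiv_fderiv_eq (hf : ContDiffAt ℝ 2 f u) (hmem : ∀ v, f v ∈ hyperbolicSpace n)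
    (a : E) : lor (fderiv ℝ (fderiv ℝ f) u a a) (f u) =
      -lor (fderiv ℝ f u a) (fderiv ℝ f u a) := by
  have h := eventually_hasDerivAt_lor_line hf hf a a
  have hc : (fun s : ℝ => lor (f (u + s • a)) (f (u + s • a))) = fun _ => -1 :=
    funext fun s => (hmem _).1
  rw [hc] at h
  have hz : (fun s : ℝ => lor (fderiv ℝ f (u + s • a) a) (f (u + s • a)) +
        lor (f (u + s • a)) (fderiv ℝ f (u + s • a) a)) =ᶠ[𝓝 0] fun _ => 0 :=
    h.mono fun s hs => hs.unique (hasDerivAt_const _ _)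
  have h0 := (hasDerivAt_deriv_lor_line hf hf a a).unique
    ((hasDerivAt_const (0 : ℝ) (0 : ℝ)).congr_of_eventuallyEq hz)
  rw [lor_comm (f u)] at h0
  linarith

variable {f₁ f₂ : E → Minkowski n} {u₁ u₂ : E}

/-- First variation of the distance at a closest pair of points. -/
lemma lor_fderiv_eq_zero_of_min (h₁ : ContDiffAt ℝ 2 f₁ u₁) (h₂ : ContDiffAt ℝ 2 f₂ u₂)
    (hmin : ∀ v w, -lor (f₁ u₁) (f₂ u₂) ≤ -lor (f₁ v) (f₂ w)) (a : E) :
    lor (f₂ u₂) (fderiv ℝ f₁ u₁ a) = 0 := by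
  have h := (eventually_hasDerivAt_lor_line h₁ h₂ a 0).self_of_nhds
  have hmax : IsLocalMax (fun s : ℝ => lor (f₁ (u₁ + s • a)) (f₂ (u₂ + s • (0 : E)))) 0 :=
    Eventually.of_forall fun s => by simpa using hmin (u₁ + s • a) u₂
  have h0 := hmax.hasDerivAt_eq_zero h
  simp only [zero_smul, add_zero, map_zero, lor_zero_right] at h0
  rw [lor_comm, h0]

/-- Second variation of the distance at a closest pair of points. -/
lemma second_variation_nonneg (h₁ : ContDiffAt ℝ 2 f₁ u₁) (h₂ : ContDiffAt ℝ 2 f₂ u₂)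
    (hmin : ∀ v w, -lor (f₁ u₁) (f₂ u₂) ≤ -lor (f₁ v) (f₂ w)) (a b : E) :
    0 ≤ -lor (fderiv ℝ (fderiv ℝ f₁) u₁ a a) (f₂ u₂) -
        2 * lor (fderiv ℝ f₁ u₁ a) (fderiv ℝ f₂ u₂ b) -
        lor (fderiv ℝ (fderiv ℝ f₂) u₂ b b) (f₁ u₁) := by
  have hlm : IsLocalMin (fun s : ℝ => -lor (f₁ (u₁ + s • a)) (f₂ (u₂ + s • b))) 0 :=
    Eventually.of_forall fun s => by simpa using hmin (u₁ + s • a) (u₂ + s • b)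
  have h := second_deriv_nonneg_of_isLocalMin hlm
    ((eventually_hasDerivAt_lor_line h₁ h₂ a b).mono fun s hs => hs.neg)
    (hasDerivAt_deriv_lor_line h₁ h₂ a b).neg
  rw [lor_comm (f₁ u₁)] at h
  linarith

end SecondVariation

/-! ### Comparison of second fundamental forms in a common frame -/

section MeanCurvature

variable {m : ℕ}

/-- The pullback of the Lorentzian inner product by the differential. -/
def metricForm (f : EuclideanSpace ℝ (Fin m) → Minkowski (m + 1)) (u : EuclideanSpace ℝ (Fin m)) :
    EuclideanSpace ℝ (Fin m) →ₗ[ℝ] EuclideanSpace ℝ (Fin m) →ₗ[ℝ] ℝ :=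
  (lorForm (m + 1)).compl₁₂ (fderiv ℝ f u).toLinearMap (fderiv ℝ f u).toLinearMap

lemma metricForm_apply (f : EuclideanSpace ℝ (Fin m) → Minkowski (m + 1))
    (u v w : EuclideanSpace ℝ (Fin m)) :
    metricForm f u v w = lor (fderiv ℝ f u v) (fderiv ℝ f u w) := rfl

/-- The second fundamental form as a bilinear form. -/
def curvatureForm (f : EuclideanSpace ℝ (Fin m) → Minkowski (m + 1)) (u : EuclideanSpace ℝ (Fin m))
    (ν : Minkowski (m + 1)) :
    EuclideanSpace ℝ (Fin m) →ₗ[ℝ] EuclideanSpace ℝ (Fin m) →ₗ[ℝ] ℝ :=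
  LinearMap.mk₂ ℝ (fun v w => -lor (fderiv ℝ (fderiv ℝ f) u v w) ν)
    (fun _ _ _ => by simp only [map_add, add_apply, lor_add_left]; ring)
    (fun _ _ _ => by
      simp only [map_smul, smul_apply, lor_smul_left, smul_eq_mul]; ring)
    (fun _ _ _ => by simp only [map_add, lor_add_left]; ring)
    (fun _ _ _ => by simp only [map_smul, lor_smul_left, smul_eq_mul]; ring)

lemma curvatureForm_apply (f : EuclideanSpace ℝ (Fin m) → Minkowski (m + 1))
    (u v w : EuclideanSpace ℝ (Fin m)) (ν : Minkowski (m + 1)) :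
    curvatureForm f u ν v w = -lor (fderiv ℝ (fderiv ℝ f) u v w) ν := rfl

variable {f₁ f₂ : EuclideanSpace ℝ (Fin m) → Minkowski (m + 1)} {u₁ u₂ : EuclideanSpace ℝ (Fin m)}

/-- At a closest pair of distinct points of two immersed hypersurfaces, comparison of the second
fundamental forms in a common orthonormal frame of the two tangent spaces, which agree as subspaces
of Minkowski space. -/
lemma exists_common_frame (h₁ : ContDiffAt ℝ 2 f₁ u₁) (h₂ : ContDiffAt ℝ 2 f₂ u₂)
    (hm₁ : ∀ v, f₁ v ∈ hyperbolicSpace (m + 1)) (hm₂ : ∀ v, f₂ v ∈ hyperbolicSpace (m + 1))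
    (hi₁ : Function.Injective (fderiv ℝ f₁ u₁)) (hi₂ : Function.Injective (fderiv ℝ f₂ u₂))
    (hmin : ∀ v w, -lor (f₁ u₁) (f₂ u₂) ≤ -lor (f₁ v) (f₂ w)) (hlt : 1 < -lor (f₁ u₁) (f₂ u₂))
    {ν₁ ν₂ : Minkowski (m + 1)}
    (hν₁ : lor (f₁ u₁) ν₁ = 0) (hν₁' : lor ν₁ ν₁ = 1) (hν₁n : ∀ v, lor (fderiv ℝ f₁ u₁ v) ν₁ = 0)
    (hν₂ : lor (f₂ u₂) ν₂ = 0) (hν₂' : lor ν₂ ν₂ = 1) (hν₂n : ∀ v, lor (fderiv ℝ f₂ u₂ v) ν₂ = 0) :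
    ∃ a b : Fin m → EuclideanSpace ℝ (Fin m),
      (∀ k l, metricForm f₁ u₁ (a k) (a l) = if k = l then 1 else 0) ∧
      (∀ k l, metricForm f₂ u₂ (b k) (b l) = if k = l then 1 else 0) ∧
      ∀ k, 0 ≤ lor (f₂ u₂) ν₁ * curvatureForm f₁ u₁ ν₁ (a k) (a k) +
        lor (f₁ u₁) ν₂ * curvatureForm f₂ u₂ ν₂ (b k) (b k) +
        2 * (-lor (f₁ u₁) (f₂ u₂) - 1) := by
  have hmin' : ∀ v w, -lor (f₂ u₂) (f₁ u₁) ≤ -lor (f₂ v) (f₁ w) := fun v w => by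
    rw [lor_comm, lor_comm (f₂ v)]; exact hmin w v
  have hlt' : 1 < -lor (f₂ u₂) (f₁ u₁) := by rwa [lor_comm]
  have hp₁ := lor_fderiv_eq_zero h₁ hm₁
  have hp₂ := lor_fderiv_eq_zero h₂ hm₂
  have hq₁ := lor_fderiv_eq_zero_of_min h₁ h₂ hmin
  have hq₂ := lor_fderiv_eq_zero_of_min h₂ h₁ hmin'
  obtain ⟨a, ha⟩ := exists_orthonormal_frame (metricForm f₁ u₁) (fun v w => lor_comm _ _)
    (fun v hv => lor_self_pos_of_tangent (hm₁ u₁) (hp₁ v)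
      fun h => hv (hi₁ (h.trans (map_zero _).symm)))
  -- Both tangent spaces fill the complement of `span {p, q}`, so each frame vector of the first is
  -- also the image of a vector for the second.
  have hb : ∀ k, ∃ b, fderiv ℝ f₂ u₂ b = fderiv ℝ f₁ u₁ (a k) := fun k =>
    mem_range_of_orthogonal (hm₁ u₁) (hm₂ u₂) hlt (fderiv ℝ f₂ u₂).toLinearMap hi₂ hq₂ hp₂
      (hp₁ (a k)) (hq₁ (a k))
  choose b hb using hb
  refine ⟨a, b, ha, fun k l => ?_, fun k => ?_⟩
  · rw [metricForm_apply, hb, hb, ← metricForm_apply, ha]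
  have hs := second_variation_nonneg h₁ h₂ hmin (a k) (b k)
  have hak : lor (fderiv ℝ f₁ u₁ (a k)) (fderiv ℝ f₁ u₁ (a k)) = 1 := by
    simpa [metricForm_apply] using ha k k
  have e₁ := lor_eq_of_normal (hm₁ u₁) (hm₂ u₂) hlt (fderiv ℝ f₁ u₁).toLinearMap hi₁ hp₁ hq₁
    hν₁ hν₁' hν₁n (fderiv ℝ (fderiv ℝ f₁) u₁ (a k) (a k))
  have e₂ := lor_eq_of_normal (hm₂ u₂) (hm₁ u₁) hlt' (fderiv ℝ f₂ u₂).toLinearMap hi₂ hp₂ hq₂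
    hν₂ hν₂' hν₂n (fderiv ℝ (fderiv ℝ f₂) u₂ (b k) (b k))
  rw [lor_fderiv_fderiv_eq h₁ hm₁, hak] at e₁
  rw [lor_fderiv_fderiv_eq h₂ hm₂, hb, hak, lor_comm (f₂ u₂) (f₁ u₁)] at e₂
  rw [hb, hak, e₁, e₂] at hs
  rw [curvatureForm_apply, curvatureForm_apply]
  linarith

end MeanCurvature

/-! ### From chart representatives to mean curvature -/

section Hypersurface

variable {m : ℕ} {N : Type*} [TopologicalSpace N] [ChartedSpace (EuclideanSpace ℝ (Fin m)) N]

lemma contDiffAt_localRep {f : N → Minkowski (m + 1)} {x : N}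
    (hf : ContMDiffAt (𝓡 m) 𝓘(ℝ, Minkowski (m + 1)) ∞ f x) :
    ContDiffAt ℝ 2 (localRep f x) (extChartAt (𝓡 m) x x) := by
  have h := (contMDiffAt_iff.1 hf).2
  rw [ModelWithCorners.range_eq_univ, contDiffWithinAt_univ] at h
  exact h.of_le ENat.LEInfty.out

lemma mfderiv_eq_fderiv_localRep {f : N → Minkowski (m + 1)} {x : N}
    (hf : ContMDiffAt (𝓡 m) 𝓘(ℝ, Minkowski (m + 1)) ∞ f x) :
    (mfderiv (𝓡 m) 𝓘(ℝ, Minkowski (m + 1)) f x :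
      EuclideanSpace ℝ (Fin m) →L[ℝ] Minkowski (m + 1)) =
      fderiv ℝ (localRep f x) (extChartAt (𝓡 m) x x) := by
  rw [(hf.mdifferentiableAt (by simp)).mfderiv, ModelWithCorners.range_eq_univ, fderivWithin_univ]
  rfl

lemma localRep_extChartAt (f : N → Minkowski (m + 1)) (x : N) :
    localRep f x (extChartAt (𝓡 m) x x) = f x := by
  simp [localRep]

lemma IsUnitNormal.lor_fderiv {f : N → Minkowski (m + 1)} {x : N} {ν : Minkowski (m + 1)}
    (h : IsUnitNormal f x ν) (v : EuclideanSpace ℝ (Fin m)) :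
    lor (fderiv ℝ (localRep f x) (extChartAt (𝓡 m) x x) v) ν = 0 := by
  have hv : v = ∑ i, v i • EuclideanSpace.single i (1 : ℝ) := by
    ext j; simp [Finset.sum_apply, Pi.single_apply]
  rw [hv, map_sum, ← lorForm_apply, map_sum, LinearMap.sum_apply]
  refine Finset.sum_eq_zero fun i _ => ?_
  rw [map_smul, map_smul, LinearMap.smul_apply, lorForm_apply]
  exact (congrArg (v i • ·) (h.normal i)).trans (smul_zero _)

lemma meanCurvature_eq_sum (f : N → Minkowski (m + 1)) (x : N) (ν : Minkowski (m + 1))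
    {a : Fin m → EuclideanSpace ℝ (Fin m)}
    (ha : ∀ k l, metricForm (localRep f x) (extChartAt (𝓡 m) x x) (a k) (a l) =
      if k = l then 1 else 0) :
    meanCurvature f x ν =
      (∑ k, curvatureForm (localRep f x) (extChartAt (𝓡 m) x x) ν (a k) (a k)) / m := by
  rw [← trace_inv_mul_of_orthonormal _ _ a ha]
  rfl

variable {N₂ : Type*} [TopologicalSpace N₂] [ChartedSpace (EuclideanSpace ℝ (Fin m)) N₂]

/-- Comparison of the mean curvatures at a closest pair of distinct points. -/
lemma meanCurvature_comparison (hm : 1 ≤ m) {f₁ : N → Minkowski (m + 1)}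
    {f₂ : N₂ → Minkowski (m + 1)} {x : N} {y : N₂}
    (h₁ : ContMDiffAt (𝓡 m) 𝓘(ℝ, Minkowski (m + 1)) ∞ f₁ x)
    (h₂ : ContMDiffAt (𝓡 m) 𝓘(ℝ, Minkowski (m + 1)) ∞ f₂ y)
    (hm₁ : ∀ z, f₁ z ∈ hyperbolicSpace (m + 1)) (hm₂ : ∀ z, f₂ z ∈ hyperbolicSpace (m + 1))
    (hi₁ : Function.Injective (mfderiv (𝓡 m) 𝓘(ℝ, Minkowski (m + 1)) f₁ x))
    (hi₂ : Function.Injective (mfderiv (𝓡 m) 𝓘(ℝ, Minkowski (m + 1)) f₂ y))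
    (hmin : ∀ z w, -lor (f₁ x) (f₂ y) ≤ -lor (f₁ z) (f₂ w)) (hlt : 1 < -lor (f₁ x) (f₂ y))
    {ν₁ ν₂ : Minkowski (m + 1)} (hν₁ : IsUnitNormal f₁ x ν₁) (hν₂ : IsUnitNormal f₂ y ν₂) :
    -2 * (-lor (f₁ x) (f₂ y) - 1) ≤
      meanCurvature f₁ x ν₁ * lor (f₂ y) ν₁ + meanCurvature f₂ y ν₂ * lor (f₁ x) ν₂ := by
  have hi₁' : Function.Injective (fderiv ℝ (localRep f₁ x) (extChartAt (𝓡 m) x x)) := by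
    rw [← mfderiv_eq_fderiv_localRep h₁]; exact hi₁
  have hi₂' : Function.Injective (fderiv ℝ (localRep f₂ y) (extChartAt (𝓡 m) y y)) := by
    rw [← mfderiv_eq_fderiv_localRep h₂]; exact hi₂
  have ex := localRep_extChartAt f₁ x
  have ey := localRep_extChartAt f₂ y
  obtain ⟨a, b, ha, hb, hab⟩ := exists_common_frame (contDiffAt_localRep h₁)
    (contDiffAt_localRep h₂) (fun v => hm₁ _) (fun v => hm₂ _) hi₁' hi₂'
    (by rw [ex, ey]; exact fun v w => hmin _ _) (by rwa [ex, ey])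
    (by rw [ex]; exact hν₁.tangent) hν₁.unit hν₁.lor_fderiv
    (by rw [ey]; exact hν₂.tangent) hν₂.unit hν₂.lor_fderiv
  rw [ex, ey] at hab
  have hsum := Finset.sum_nonneg fun k (_ : k ∈ Finset.univ) => hab k
  rw [Finset.sum_add_distrib, Finset.sum_add_distrib, ← Finset.mul_sum, ← Finset.mul_sum,
    Finset.sum_const, Finset.card_univ, Fintype.card_fin, nsmul_eq_mul] at hsum
  have hm0 : (0 : ℝ) < m := by exact_mod_cast hm
  rw [meanCurvature_eq_sum f₁ x ν₁ ha, meanCurvature_eq_sum f₂ y ν₂ hb, div_mul_eq_mul_div,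
    div_mul_eq_mul_div, ← add_div, le_div_iff₀ hm0]
  linarith

end Hypersurface

/-! ### Real-variable inequalities -/

section Real

/-- The difference of the two sides vanishes at `0` and has derivative `k (cosh (k r) - cosh r) ≥
0`. -/
lemma mul_sinh_le_sinh_mul {k a : ℝ} (hk : 1 ≤ k) (ha : 0 ≤ a) :
    k * Real.sinh a ≤ Real.sinh (k * a) := by
  have hmono : MonotoneOn (fun r => Real.sinh (k * r) - k * Real.sinh r) (Set.Ici 0) := by
    have hd (r : ℝ) : HasDerivAt (fun r => Real.sinh (k * r) - k * Real.sinh r)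
        (Real.cosh (k * r) * k - k * Real.cosh r) r := by
      refine ((((hasDerivAt_id r).const_mul k).sinh).sub
        ((Real.hasDerivAt_sinh r).const_mul k)).congr_deriv ?_
      simp
    refine monotoneOn_of_deriv_nonneg (convex_Ici 0) (by fun_prop)
      (fun r _ => (hd r).differentiableAt.differentiableWithinAt) fun r hr => ?_
    rw [interior_Ici] at hr
    have hr0 : 0 < r := hr
    rw [(hd r).deriv]
    have : Real.cosh r ≤ Real.cosh (k * r) := by
      rw [Real.cosh_le_cosh, abs_of_pos hr0, abs_of_pos (by positivity)]
      nlinarith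
    nlinarith
  have h := hmono (Set.self_mem_Ici) ha ha
  simp only [mul_zero, Real.sinh_zero, sub_zero] at h
  linarith

/-- A function which is larger before `t` than at `t` has nonpositive left derivative at `t`. -/
lemma deriv_nonpos_of_le_left {φ : ℝ → ℝ} {φ' t : ℝ} {s : Set ℝ} (ht : 0 < t)
    (hs : Set.Ico 0 t ⊆ s) (h : HasDerivWithinAt φ φ' s t) (hle : ∀ r ∈ Set.Ico 0 t, φ t ≤ φ r) :
    φ' ≤ 0 := by
  have h' := h.mono hs
  rw [hasDerivWithinAt_iff_tendsto_slope' (by simp)] at h'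
  have : (nhdsWithin t (Set.Ico 0 t)).NeBot := by
    rw [← mem_closure_iff_nhdsWithin_neBot, closure_Ico ht.ne]
    exact ⟨ht.le, le_rfl⟩
  refine le_of_tendsto h' ?_
  filter_upwards [self_mem_nhdsWithin] with r hr
  rw [slope_def_field]
  exact div_nonpos_of_nonneg_of_nonpos (by linarith [hle r hr]) (by linarith [hr.2])

end Real

/-- Nonemptiness matters: the real infimum of the empty set is `0` by convention. -/
lemma le_flowDist {m : ℕ} {N N₂ : Type*} [Nonempty N] [Nonempty N₂]
    {F₁ : N → ℝ → Minkowski (m + 1)} {F₂ : N₂ → ℝ → Minkowski (m + 1)} {t r : ℝ}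
    (h : ∀ x y, r ≤ hdist (F₁ x t) (F₂ y t)) : r ≤ flowDist F₁ F₂ t := by
  obtain ⟨x⟩ := ‹Nonempty N›
  obtain ⟨y⟩ := ‹Nonempty N₂›
  refine le_csInf ⟨_, _, ⟨x, rfl⟩, _, ⟨y, rfl⟩, rfl⟩ ?_
  rintro _ ⟨_, ⟨z, rfl⟩, _, ⟨w, rfl⟩, rfl⟩
  exact h z w

/-! ### Evolution of the distance and the maximum principle -/

section Flow

variable {m : ℕ} {N : Type*} [TopologicalSpace N] [ChartedSpace (EuclideanSpace ℝ (Fin m)) N]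
  {T : ℝ} {F : N → ℝ → Minkowski (m + 1)}

lemma IsMCF.contMDiffAt (h : IsMCF T F) {t : ℝ} (ht : t ∈ Set.Ico 0 T) (x : N) :
    ContMDiffAt (𝓡 m) 𝓘(ℝ, Minkowski (m + 1)) ∞ (fun y => F y t) x := by
  have hc : ContMDiff (𝓡 m) ((𝓡 m).prod 𝓘(ℝ, ℝ)) ∞ fun y : N => (y, t) :=
    contMDiff_id.prodMk contMDiff_const
  have h' := h.smooth.comp_contMDiff hc fun y => ⟨Set.mem_univ _, ht⟩
  exact h' x

lemma IsMCF.continuous (h : IsMCF T F) :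
    Continuous fun p : N × Set.Ico (0 : ℝ) T => F p.1 p.2 := by
  have hc : Continuous fun p : N × Set.Ico (0 : ℝ) T => (p.1, (p.2 : ℝ)) := by fun_prop
  exact h.smooth.continuousOn.comp_continuous hc fun p => ⟨Set.mem_univ _, p.2.2⟩

variable {N₂ : Type*} [TopologicalSpace N₂] [ChartedSpace (EuclideanSpace ℝ (Fin m)) N₂]
  {F₁ : N → ℝ → Minkowski (m + 1)} {F₂ : N₂ → ℝ → Minkowski (m + 1)}

/-- The derivative of `cosh d - 1` along two flows at a closest pair of distinct points. -/
lemma exists_hasDerivWithinAt_ge (hm : 1 ≤ m) (h₁ : IsMCF T F₁) (h₂ : IsMCF T F₂) {t : ℝ}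
    (ht : t ∈ Set.Ico 0 T) {x : N} {y : N₂} (hlt : 1 < -lor (F₁ x t) (F₂ y t))
    (hmin : ∀ z w, -lor (F₁ x t) (F₂ y t) ≤ -lor (F₁ z t) (F₂ w t)) :
    ∃ v, HasDerivWithinAt (fun s => -lor (F₁ x s) (F₂ y s) - 1) v (Set.Ico 0 T) t ∧
      -2 * (-lor (F₁ x t) (F₂ y t) - 1) ≤ v := by
  obtain ⟨ν₁, hν₁, hd₁⟩ := h₁.flow x t ht
  obtain ⟨ν₂, hν₂, hd₂⟩ := h₂.flow y t ht
  refine ⟨_, (HasDerivWithinAt.lor hd₁ hd₂).neg.sub_const 1, ?_⟩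
  have h := meanCurvature_comparison hm (h₁.contMDiffAt ht x) (h₂.contMDiffAt ht y)
    (fun z => h₁.mem z t ht) (fun z => h₂.mem z t ht) (h₁.immersion x t ht) (h₂.immersion y t ht)
    hmin hlt hν₁ hν₂
  refine h.trans (le_of_eq ?_)
  rw [lor_neg_left, lor_neg_right, lor_smul_left, lor_smul_right, lor_comm ν₁]
  ring

/-- Pairs of points at bounded distance stay in a compact set, up to any time `t₁ < T`. -/
lemma isCompact_sublevel [CompactSpace N] (h₁ : IsMCF T F₁) (h₂ : IsMCF T F₂)
    (hproper : IsProperFlow T F₂) (lam c : ℝ) {t₁ : ℝ} (ht₁ : t₁ ∈ Set.Ico 0 T) (hlam : 0 ≤ lam) :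
    IsCompact {z : N × N₂ × Set.Ico (0 : ℝ) T | (z.2.2 : ℝ) ≤ t₁ ∧
      Real.exp (lam * z.2.2) * (-lor (F₁ z.1 z.2.2) (F₂ z.2.1 z.2.2) - 1) ≤ c} := by
  have hI : IsCompact {s : Set.Ico (0 : ℝ) T | (s : ℝ) ≤ t₁} := by
    rw [Subtype.isCompact_iff]
    convert isCompact_Icc (a := (0 : ℝ)) (b := t₁) using 1
    ext s
    simp only [Set.mem_image, Set.mem_ofPred_eq, Subtype.exists, Set.mem_Icc, Set.mem_Ico]
    constructor
    · rintro ⟨a, ha, hb, rfl⟩; exact ⟨ha.1, hb⟩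
    · rintro ⟨h0, h1⟩; exact ⟨s, ⟨h0, h1.trans_lt ht₁.2⟩, h1, rfl⟩
  have hc₁ := h₁.continuous
  have hc₂ := h₂.continuous
  obtain ⟨R, hR⟩ := ((isCompact_univ (X := N)).prod hI).bddAbove_image
    (f := fun p : N × Set.Ico (0 : ℝ) T => (F₁ p.1 p.2).1) hc₁.fst.continuousOn
  -- `R` bounds the time coordinate of the compact flow up to `t₁`, and the sublevel condition gives
  -- `-⟨p, q⟩ ≤ c + 1`; `fst_le_of_mem` then confines the second point to this ball.
  have hK := hproper.isCompact_preimage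
    ((isCompact_closedBall (0 : Minkowski (m + 1)) (2 * R * (c + 1))).prod hI)
  refine ((isCompact_univ (X := N)).prod hK).of_isClosed_subset ?_ ?_
  · have hl : Continuous fun z : N × N₂ × Set.Ico (0 : ℝ) T =>
        lor (F₁ z.1 z.2.2) (F₂ z.2.1 z.2.2) := by
      have ha : Continuous fun z : N × N₂ × Set.Ico (0 : ℝ) T => F₁ z.1 z.2.2 :=
        hc₁.comp (by fun_prop : Continuous fun z : N × N₂ × Set.Ico (0 : ℝ) T => (z.1, z.2.2))
      have hb : Continuous fun z : N × N₂ × Set.Ico (0 : ℝ) T => F₂ z.2.1 z.2.2 :=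
        hc₂.comp (by fun_prop : Continuous fun z : N × N₂ × Set.Ico (0 : ℝ) T => (z.2.1, z.2.2))
      exact continuous_lor.comp (ha.prodMk hb)
    have ht : Continuous fun z : N × N₂ × Set.Ico (0 : ℝ) T => (z.2.2 : ℝ) := by fun_prop
    exact (isClosed_le ht continuous_const).inter (isClosed_le
      ((Real.continuous_exp.comp (continuous_const.mul ht)).mul (hl.neg.sub continuous_const))
      continuous_const)
  · rintro ⟨x, y, s⟩ ⟨hs, hle⟩
    refine ⟨Set.mem_univ _, ?_, hs⟩
    simp only at hs hle
    have hp := h₁.mem x s s.2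
    have hq := h₂.mem y s s.2
    have hRx : (F₁ x s).1 ≤ R := hR ⟨(x, s), ⟨Set.mem_univ _, hs⟩, rfl⟩
    have hone := one_le_neg_lor hp hq
    have hexp : 1 ≤ Real.exp (lam * s) := Real.one_le_exp (mul_nonneg hlam s.2.1)
    have hZ : -lor (F₁ x s) (F₂ y s) ≤ c + 1 := by nlinarith
    rw [mem_closedBall_zero_iff]
    refine (norm_le_fst_of_mem hq).trans ((fst_le_of_mem hp hq).trans ?_)
    have hp0 := hp.2
    exact mul_le_mul (by linarith) hZ (by linarith) (by linarith)

/-- The maximum principle: `exp (lam * t) * (cosh d - 1)` stays above any initial lower bound. -/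
lemma lower_bound_of_two_lt [CompactSpace N] (hm : 1 ≤ m) (h₁ : IsMCF T F₁) (h₂ : IsMCF T F₂)
    (hproper : IsProperFlow T F₂) {lam c : ℝ} (hlam : 2 < lam) (hc : 0 < c)
    (h0 : ∀ x y, c < -lor (F₁ x 0) (F₂ y 0) - 1) {t : ℝ} (ht : t ∈ Set.Ico 0 T) (x : N) (y : N₂) :
    c ≤ Real.exp (lam * t) * (-lor (F₁ x t) (F₂ y t) - 1) := by
  by_contra! hcon
  -- The set of times up to `t` at which some pair has reached `c` is compact, so it has a least
  -- element `s`.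
  have hcomp := (isCompact_sublevel h₁ h₂ hproper lam c ht (by linarith)).image
    (f := fun z : N × N₂ × Set.Ico (0 : ℝ) T => (z.2.2 : ℝ)) (by fun_prop)
  obtain ⟨_, ⟨⟨x', y', s⟩, ⟨hst, hle⟩, rfl⟩, hleast⟩ :=
    hcomp.exists_isLeast ⟨t, (x, y, ⟨t, ht⟩), ⟨le_rfl, hcon.le⟩, rfl⟩
  simp only at hst hle hleast
  have hbefore : ∀ z w, ∀ r ∈ Set.Ico 0 (s : ℝ),
      c < Real.exp (lam * r) * (-lor (F₁ z r) (F₂ w r) - 1) := by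
    intro z w r hr
    by_contra! hr'
    have hrT : r ∈ Set.Ico 0 T := ⟨hr.1, hr.2.trans s.2.2⟩
    exact absurd (hleast ⟨(z, w, ⟨r, hrT⟩), ⟨hr.2.le.trans hst, hr'⟩, rfl⟩) (not_le.2 hr.2)
  have hspos : 0 < (s : ℝ) := by
    refine lt_of_le_of_ne s.2.1 fun h => ?_
    rw [← h, mul_zero, Real.exp_zero, one_mul] at hle
    exact absurd (h0 x' y') (not_lt.2 hle)
  have hcl : (nhdsWithin (s : ℝ) (Set.Ico 0 (s : ℝ))).NeBot := by
    rw [← mem_closure_iff_nhdsWithin_neBot, closure_Ico hspos.ne]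
    exact ⟨hspos.le, le_rfl⟩
  have hsub : Set.Ico 0 (s : ℝ) ⊆ Set.Ico 0 T := Set.Ico_subset_Ico_right s.2.2.le
  have hexpd : HasDerivWithinAt (fun r => Real.exp (lam * r)) (Real.exp (lam * s) * lam)
      (Set.Ico 0 T) s := by
    simpa using (((hasDerivAt_id (s : ℝ)).const_mul lam).exp).hasDerivWithinAt
  -- The strict bound before `s` passes to a weak one at `s` by continuity in time. Since the pair
  -- `x', y'` is at or below `c`, it is a closest pair at time `s`, and `c > 0` keeps its points
  -- distinct.
  have hafter : ∀ z w, c ≤ Real.exp (lam * s) * (-lor (F₁ z s) (F₂ w s) - 1) := by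
    intro z w
    obtain ⟨_, _, hd₁⟩ := h₁.flow z s s.2
    obtain ⟨_, _, hd₂⟩ := h₂.flow w s s.2
    have hd := (hexpd.mul ((HasDerivWithinAt.lor hd₁ hd₂).neg.sub_const 1)).mono hsub
    refine ge_of_tendsto hd.continuousWithinAt ?_
    filter_upwards [self_mem_nhdsWithin] with r hr using (hbefore z w r hr).le
  have hpos := Real.exp_pos (lam * s)
  have hZ : 0 < -lor (F₁ x' s) (F₂ y' s) - 1 :=
    pos_of_mul_pos_right (hc.trans_le (hafter x' y')) hpos.le
  obtain ⟨v, hv, hge⟩ := exists_hasDerivWithinAt_ge hm h₁ h₂ s.2 (x := x') (y := y') (by linarith)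
    fun z w => by
      have := le_of_mul_le_mul_left (hle.trans (hafter z w)) hpos
      linarith
  have hneg := deriv_nonpos_of_le_left hspos hsub (hexpd.mul hv)
    fun r hr => hle.trans (hbefore x' y' r hr).le
  -- Here `v ≥ -2Z`, `Z > 0` and `lam > 2` make the derivative strictly positive, whereas approach
  -- from above requires it to be nonpositive.
  have : 0 < Real.exp (lam * s) * (lam * (-lor (F₁ x' s) (F₂ y' s) - 1) + v) :=
    mul_pos hpos (by nlinarith)
  linarith

/-- Limit of the strict version: the exponent decreases to `2` and the level increases to `c`.
Levels `b ≤ 0` are trivial because `Z ≥ 0`. -/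
lemma lower_bound [CompactSpace N] (hm : 1 ≤ m) (h₁ : IsMCF T F₁) (h₂ : IsMCF T F₂)
    (hproper : IsProperFlow T F₂) {c : ℝ}
    (h0 : ∀ x y, c ≤ -lor (F₁ x 0) (F₂ y 0) - 1) {t : ℝ} (ht : t ∈ Set.Ico 0 T) (x : N) (y : N₂) :
    c ≤ Real.exp (2 * t) * (-lor (F₁ x t) (F₂ y t) - 1) := by
  have hZ : 0 ≤ -lor (F₁ x t) (F₂ y t) - 1 := by
    linarith [one_le_neg_lor (h₁.mem x t ht) (h₂.mem y t ht)]
  refine le_of_forall_lt fun c' hc' => ?_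
  obtain ⟨b, hb, hbc⟩ := exists_between hc'
  refine hb.trans_le ?_
  rcases le_or_gt b 0 with hb0 | hb0
  · exact hb0.trans (by positivity)
  have hcont : Filter.Tendsto (fun lam => Real.exp (lam * t) * (-lor (F₁ x t) (F₂ y t) - 1))
      (nhdsWithin 2 (Set.Ioi 2)) (nhds (Real.exp (2 * t) * (-lor (F₁ x t) (F₂ y t) - 1))) :=
    (Continuous.tendsto (by fun_prop) 2).mono_left nhdsWithin_le_nhds
  refine ge_of_tendsto hcont ?_
  filter_upwards [self_mem_nhdsWithin] with lam hlam
  exact lower_bound_of_two_lt hm h₁ h₂ hproper hlam hb0 (fun x y => hbc.trans_le (h0 x y)) ht x y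

lemma flowDist_le (h₁ : IsMCF T F₁) (h₂ : IsMCF T F₂) {t : ℝ} (ht : t ∈ Set.Ico 0 T) (x : N)
    (y : N₂) : flowDist F₁ F₂ t ≤ hdist (F₁ x t) (F₂ y t) := by
  refine csInf_le ⟨0, ?_⟩ ⟨_, ⟨x, rfl⟩, _, ⟨y, rfl⟩, rfl⟩
  rintro _ ⟨_, ⟨z, rfl⟩, _, ⟨w, rfl⟩, rfl⟩
  exact hdist_nonneg (h₁.mem z t ht) (h₂.mem w t ht)

lemma sinh_half_flowDist_le [CompactSpace N] [Nonempty N] [Nonempty N₂] (hm : 1 ≤ m)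
    (h₁ : IsMCF T F₁) (h₂ : IsMCF T F₂) (hproper : IsProperFlow T F₂) {t : ℝ}
    (ht : t ∈ Set.Ico 0 T) :
    Real.sinh (flowDist F₁ F₂ 0 / 2) ≤ Real.exp t * Real.sinh (flowDist F₁ F₂ t / 2) := by
  have h0T : (0 : ℝ) ∈ Set.Ico 0 T := ⟨le_rfl, ht.1.trans_lt ht.2⟩
  have hd0 : 0 ≤ flowDist F₁ F₂ 0 :=
    le_flowDist fun x y => hdist_nonneg (h₁.mem x 0 h0T) (h₂.mem y 0 h0T)
  set S := Real.sinh (flowDist F₁ F₂ 0 / 2) with hS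
  have hS0 : 0 ≤ S := Real.sinh_nonneg_iff.2 (by linarith)
  have hinit : ∀ x y, 2 * S ^ 2 ≤ -lor (F₁ x 0) (F₂ y 0) - 1 := fun x y => by
    rw [← two_mul_sinh_half_hdist_sq (h₁.mem x 0 h0T) (h₂.mem y 0 h0T)]
    have : S ≤ Real.sinh (hdist (F₁ x 0) (F₂ y 0) / 2) :=
      Real.sinh_le_sinh.2 (by linarith [flowDist_le h₁ h₂ h0T x y])
    gcongr
  have hpt : ∀ x y, S ≤ Real.exp t * Real.sinh (hdist (F₁ x t) (F₂ y t) / 2) := fun x y => by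
    have hp := h₁.mem x t ht
    have hq := h₂.mem y t ht
    have h := lower_bound hm h₁ h₂ hproper hinit ht x y
    rw [← two_mul_sinh_half_hdist_sq hp hq, two_mul t, Real.exp_add] at h
    have hs : 0 ≤ Real.sinh (hdist (F₁ x t) (F₂ y t) / 2) :=
      Real.sinh_nonneg_iff.2 (by linarith [hdist_nonneg hp hq])
    exact le_of_sq_le_sq (by nlinarith) (by positivity)
  -- Inverting `sinh` turns the pointwise estimate into a uniform lower bound for distances, which
  -- passes to the infimum without its being attained.
  have hle : 2 * Real.arsinh (Real.exp (-t) * S) ≤ flowDist F₁ F₂ t := le_flowDist fun x y => by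
    have h : Real.exp (-t) * S ≤ Real.sinh (hdist (F₁ x t) (F₂ y t) / 2) := by
      rw [Real.exp_neg, inv_mul_le_iff₀ (Real.exp_pos t)]
      exact hpt x y
    have h' := Real.arsinh_le_arsinh.2 h
    rw [Real.arsinh_sinh] at h'
    linarith
  have h : Real.exp (-t) * S ≤ Real.sinh (flowDist F₁ F₂ t / 2) := by
    rw [← Real.sinh_arsinh (Real.exp (-t) * S)]
    exact Real.sinh_le_sinh.2 (by linarith)
  rwa [Real.exp_neg, inv_mul_le_iff₀ (Real.exp_pos t)] at h

end Flow

end HypMCF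

end

theorem theorem3p1 (m : ℕ) (hm : 1 ≤ m)
    {N₁ : Type*} [TopologicalSpace N₁] [T2Space N₁] [SecondCountableTopology N₁] [Nonempty N₁]
    [ChartedSpace (EuclideanSpace ℝ (Fin m)) N₁] [IsManifold (𝓡 m) ∞ N₁] [CompactSpace N₁]
    {N₂ : Type*} [TopologicalSpace N₂] [T2Space N₂] [SecondCountableTopology N₂] [Nonempty N₂]
    [ChartedSpace (EuclideanSpace ℝ (Fin m)) N₂] [IsManifold (𝓡 m) ∞ N₂]
    (T : ℝ) (F₁ : N₁ → ℝ → HypMCF.Minkowski (m + 1)) (F₂ : N₂ → ℝ → HypMCF.Minkowski (m + 1))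
    (h₁ : HypMCF.IsMCF T F₁) (h₂ : HypMCF.IsMCF T F₂) (hproper : HypMCF.IsProperFlow T F₂)
    (t : ℝ) (ht : t ∈ Set.Ico 0 T) :
    Real.sinh (HypMCF.flowDist F₁ F₂ 0 / 2)
        ≤ Real.exp t * Real.sinh (HypMCF.flowDist F₁ F₂ t / 2) ∧
      HypMCF.flowDist F₁ F₂ 0 ≤ Real.exp t * HypMCF.flowDist F₁ F₂ t := by
  have hs := HypMCF.sinh_half_flowDist_le hm h₁ h₂ hproper ht
  refine ⟨hs, ?_⟩
  have hd : 0 ≤ HypMCF.flowDist F₁ F₂ t :=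
    HypMCF.le_flowDist fun x y => HypMCF.hdist_nonneg (h₁.mem x t ht) (h₂.mem y t ht)
  -- With `k = exp t ≥ 1` and `a = d(t)/2`, the bound becomes `sinh (d(0)/2) ≤ sinh (exp t *
  -- d(t)/2)`.
  have h := Real.sinh_le_sinh.1 (hs.trans
    (HypMCF.mul_sinh_le_sinh_mul (Real.one_le_exp ht.1) (by linarith)))
  linarith
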